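/- Conventions. Let $S=\mathbb{R}_{\ge 0}^N$ and let $G$ be a group. For $f:S\to G$ and $s\in S$ put $L_s(f)(t)=f(s+t)f(t)^{-1}$ and $R_s(f)(t)=f(t)^{-1}f(s+t)$. The map $f$ is a polynomial map of degree $\le-\infty$ if $f\equiv 1_G$, of degree $\le 0$ if it is constant, and of degree $\le e+1$ ($e\in\mathbb{N}_0$) if $L_s(f)$ and $R_s(f)$ are polynomial maps of degree $\le e$ for all $s\in S$; its degree is the least such element of $\{-\infty\}\cup\mathbb{N}_0$. We use $-\infty+x=-\infty$. Let $C^1G=G$, $C^{i+1}G=[C^iG,G]$. If $G$ is nilpotent of class $c$, the lc-degree of a polynomial map $f:S\to G$ is the vector $(d_1,\dots,d_c)$, where $d_i$ is the degree of $f \bmod C^{i+1}G$. Theorem. Let $n\ge 2$, $N\ge 0$, and for $1\le i<j\le n$ let $f_{i,j}:\mathbb{R}_{\ge0}^N\to\mathbb{R}$ be a continuous polynomial map of degree exactly $d_{i,j}\in\{-\infty\}\cup\mathbb{N}_0$ (with $d_{i,j}=-\infty$ iff $f_{i,j}\equiv 0$). Put $d_{i,i}=0$. Let $f:\mathbb{R}_{\ge0}^N\to\mathcal{U}_n(\mathbb{R})$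 be the map to the group of real upper unitriangular $n\times n$ matrices whose $(i,j)$-entry is $f_{i,j}$ for $i<j$. Then $\mathcal{U}_n(\mathbb{R})$ is nilpotent of class $n-1$, $f$ is a polynomial map, and its lc-degree $(d_1,\dots,d_{n-1})$ satisfies $$d_1=\max\{d_{k,k+1}\mid 1\le k\le n-1\},$$ and, for $2\le i\le n-1$, $d_{i-1}\le d_i$ and $$d_i\le\max\{d_{k_1,k_2}+\cdots+d_{k_i,k_{i+1}}\mid 1\le k_1\le k_2\le\cdots\le k_{i+1}\le n,\ k_1<k_{i+1}\le k_1+i\}.$$ If moreover none of the entries $f_{1,2},f_{2,3},\dots,f_{n-1,n}$ is identically zero, then for $2\le i\le n-1$ $$d_i\le\max\{d_{k_1,k_2}+\cdots+d_{k_i,k_{i+1}}\mid 1\le k_1\le k_2\le\cdots\le k_i\le k_{i+1}=k_1+i\le n\}.$$ Finally, $d_{n-1}$ is the degree of $f$, and each of the two upper bounds, with $i=n-1$, holds for $d_{n-1}$ (the second one under the same condition), also when $n=2$. -/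

import Mathlib

open scoped NNReal

namespace PolyMap

section PolynomialMaps

variable {S G : Type*} [AddCommSemigroup S] [Group G]

/-- The left forward difference `L_s(f) : t ↦ f(s+t) f(t)⁻¹`. -/
def leftDiff (s : S) (f : S → G) : S → G := fun t => f (s + t) * (f t)⁻¹

/-- The right forward difference `R_s(f) : t ↦ f(t)⁻¹ f(s+t)`. -/
def rightDiff (s : S) (f : S → G) : S → G := fun t => (f t)⁻¹ * f (s + t)

/-- `f` is a polynomial map of degree `≤ d`, for a natural number `d`: the map `f` is constant if
`d = 0`, and all left and right forward differences of `f` have degree `≤ d` in the case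
of `d + 1`. -/
def DegreeLENat : ℕ → (S → G) → Prop
  | 0, f => ∃ c : G, ∀ t, f t = c
  | d + 1, f => ∀ s : S, DegreeLENat d (leftDiff s f) ∧ DegreeLENat d (rightDiff s f)

/-- `f` is a polynomial map of degree `≤ d`, for `d` in `{-∞} ∪ ℕ` (`⊥` stands for `-∞`);
degree `-∞` means that `f` is identically `1`. -/
def DegreeLE (f : S → G) : WithBot ℕ → Prop
  | none => ∀ t, f t = 1
  | some d => DegreeLENat d f

/-- `f` is a polynomial map. -/
def IsPolynomialMap (f : S → G) : Prop := ∃ d : WithBot ℕ, DegreeLE f d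

/-- `f` is a polynomial map of degree (exactly) `d`, i.e. `d` is the least element of `{-∞} ∪ ℕ`
such that `f` is a polynomial map of degree `≤ d`. -/
def HasDegree (f : S → G) (d : WithBot ℕ) : Prop := IsLeast {e | DegreeLE f e} d

/-- A map to an additive group, viewed as a map to the corresponding multiplicative group. -/
def toMul {A : Type*} (f : S → A) : S → Multiplicative A := fun t => Multiplicative.ofAdd (f t)

/-- The reduction of `f` modulo `C^{i+1} G`, the `(i+1)`-st term of the lower central series
`C^1 G = G`, `C^{j+1} G = [C^j G, G]` (Mathlib's numbering starts at `0`). -/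
def modLC (f : S → G) (i : ℕ) : S → G ⧸ Subgroup.lowerCentralSeries (⊤ : Subgroup G) i :=
  fun t => (f t : G ⧸ Subgroup.lowerCentralSeries (⊤ : Subgroup G) i)

/-- `(δ 1, …, δ c)`, where `c` is the nilpotency class of the nilpotent group `G`, is the lc-degree
of `f : S → G`: `δ i` is the degree of `f` modulo `C^{i+1} G`. The other values of `δ` play no
role. -/
def IsLCDegree (f : S → G) (δ : ℕ → WithBot ℕ) : Prop :=
  ∀ i, 1 ≤ i → i ≤ Group.nilpotencyClass G → HasDegree (modLC f i) (δ i)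

end PolynomialMaps

section Unitriangular

/-- The entries of a matrix are those of an upper unitriangular matrix. -/
def IsUnitriangular {n : ℕ} (A : Matrix (Fin n) (Fin n) ℝ) : Prop :=
  (∀ i, A i i = 1) ∧ ∀ i j, j < i → A i j = 0

theorem IsUnitriangular.mul {n : ℕ} {A B : Matrix (Fin n) (Fin n) ℝ}
    (hA : IsUnitriangular A) (hB : IsUnitriangular B) : IsUnitriangular (A * B) := by
  constructor
  · intro i
    rw [Matrix.mul_apply, Finset.sum_eq_single i]
    · rw [hA.1, hB.1, one_mul]
    · intro k _ hk
      rcases lt_or_gt_of_ne hk with h | h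
      · rw [hA.2 i k h, zero_mul]
      · rw [hB.2 k i h, mul_zero]
    · simp
  · intro i j hij
    rw [Matrix.mul_apply]
    refine Finset.sum_eq_zero fun k _ => ?_
    rcases lt_or_ge k i with h | h
    · rw [hA.2 i k h, zero_mul]
    · rw [hB.2 k j (lt_of_lt_of_le hij h), mul_zero]

theorem IsUnitriangular.of_mul_eq_one {n : ℕ} {A B : Matrix (Fin n) (Fin n) ℝ}
    (hA : IsUnitriangular A) (hAB : A * B = 1) (hBA : B * A = 1) : IsUnitriangular B := by
  have hB0 : ∀ i j, j < i → B i j = 0 := by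
    have : Invertible A := ⟨B, hBA, hAB⟩
    have hT : Matrix.BlockTriangular A (id : Fin n → Fin n) := fun i j h => hA.2 i j h
    have h := Matrix.blockTriangular_inv_of_blockTriangular hT
    rw [Matrix.inv_eq_right_inv hAB] at h
    exact fun i j hij => h hij
  refine ⟨fun i => ?_, hB0⟩
  have h := congrFun (congrFun hAB i) i
  rw [Matrix.mul_apply, Finset.sum_eq_single i, hA.1, one_mul, Matrix.one_apply_eq] at h
  · exact h
  · intro k _ hk
    rcases lt_or_gt_of_ne hk with h | h
    · rw [hA.2 i k h, zero_mul]
    · rw [hB0 k i h, mul_zero]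
  · simp

/-- The group `U_n(ℝ)` of real upper unitriangular `n × n` matrices. -/
def UT (n : ℕ) : Subgroup (GL (Fin n) ℝ) where
  carrier := {g | IsUnitriangular (g : Matrix (Fin n) (Fin n) ℝ)}
  mul_mem' := by
    intro a b ha hb
    exact IsUnitriangular.mul ha hb
  one_mem' := ⟨fun i => Matrix.one_apply_eq i, fun i j h => Matrix.one_apply_ne h.ne'⟩
  inv_mem' := by
    intro a ha
    exact IsUnitriangular.of_mul_eq_one ha a.mul_inv a.inv_mul

/-- The `(i,j)`-entry of an element of `U_n(ℝ)`. -/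
def UT.entry {n : ℕ} (g : UT n) (i j : Fin n) : ℝ :=
  ((g : GL (Fin n) ℝ) : Matrix (Fin n) (Fin n) ℝ) i j

end Unitriangular

section Chains

/-- The sum `d_{k₁,k₂} + ⋯ + d_{kᵢ,kᵢ₊₁}` along a chain `k₁, …, kᵢ₊₁`, where `d_{a,a}` is `0`. -/
def chainSum {n : ℕ} (d : Fin n → Fin n → WithBot ℕ) {i : ℕ} (k : Fin (i + 1) → Fin n) :
    WithBot ℕ :=
  ∑ j : Fin i, if k j.castSucc = k j.succ then 0 else d (k j.castSucc) (k j.succ)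

/-- All sums along chains `k₁ ≤ k₂ ≤ ⋯ ≤ kᵢ ≤ kᵢ₊₁ = k₁ + i` in `{1, …, n}`. -/
def chainSums {n : ℕ} (d : Fin n → Fin n → WithBot ℕ) (i : ℕ) : Set (WithBot ℕ) :=
  {x | ∃ k : Fin (i + 1) → Fin n,
    Monotone k ∧ (k (Fin.last i) : ℕ) = (k 0 : ℕ) + i ∧ x = chainSum d k}

/-- All sums along chains `k₁ ≤ k₂ ≤ ⋯ ≤ kᵢ ≤ kᵢ₊₁` in `{1, …, n}` with
`k₁ < kᵢ₊₁ ≤ k₁ + i`. -/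
def shortChainSums {n : ℕ} (d : Fin n → Fin n → WithBot ℕ) (i : ℕ) : Set (WithBot ℕ) :=
  {x | ∃ k : Fin (i + 1) → Fin n,
    Monotone k ∧ k 0 < k (Fin.last i) ∧ (k (Fin.last i) : ℕ) ≤ (k 0 : ℕ) + i ∧ x = chainSum d k}

/-- The numbers `d_{k,k+1}`, for `1 ≤ k ≤ n - 1`. -/
def superdiagonal {n : ℕ} (d : Fin n → Fin n → WithBot ℕ) : Set (WithBot ℕ) :=
  {x | ∃ a b : Fin n, (b : ℕ) = (a : ℕ) + 1 ∧ x = d a b}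

end Chains

end PolyMap

/-! The group $C^{i+1}$ of $\mathcal{U}_n(\mathbb{R})$ consists of the matrices whose first $i$
superdiagonals vanish (`UT.lowerCentralSeries_eq_band`), so $d_i$ depends only on the entries
$(j,k)$ with $j<k\le j+i$.

Give each such entry a strict degree bound $w_{jk}$, where $w_{jk}=0$ means that the entry vanishes
identically. If $w_{jl}+w_{lk}\le w_{jk}+1$ whenever both summands are nonzero, the bounds are
inherited by inverses, and $L_s$ and $R_s$ lower all of them by one (`EntriesLT.leftDiff`,
`EntriesLT.rightDiff`). Iterating until all relevant entries are constant bounds the degree of `f`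
modulo $C^{i+1}$ by that of the largest weight (`EntriesLT.degreeLE_modLC`).

A suitable $w_{jk}$ comes from the largest sum of degrees along strict chains from $j$ to $k$:
concatenating chains gives the inequality. Padding chains with repetitions yields the first upper
bound. If no superdiagonal entry is zero, chains can be lengthened at either end without decreasing
the sum, which yields the second. The formula for $d_1$ is an equality because each superdiagonal
entry is a homomorphism factoring through the abelianization. -/

namespace PolyMap

/-! ### The lower central series of the unitriangular group -/

namespace UT

open scoped commutatorElement

variable {n : ℕ}

theorem entry_mul (g h : UT n) (j k : Fin n) :
    entry (g * h) j k = ∑ l, entry g j l * entry h l k := rfl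

theorem entry_one (j k : Fin n) : entry (1 : UT n) j k = if j = k then 1 else 0 :=
  Matrix.one_apply

theorem entry_self (g : UT n) (j : Fin n) : entry g j j = 1 := g.2.1 j

theorem entry_of_lt (g : UT n) {j k : Fin n} (h : k < j) : entry g j k = 0 := g.2.2 j k h

@[ext] theorem ext {g h : UT n} (H : ∀ j k, entry g j k = entry h j k) : g = h :=
  Subtype.ext (Units.ext (Matrix.ext H))

/-- The element of `U_n(ℝ)` given by a unitriangular matrix. -/
noncomputable def ofMatrix (A : Matrix (Fin n) (Fin n) ℝ) (hA : IsUnitriangular A) : UT n :=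
  ⟨Matrix.GeneralLinearGroup.mkOfDetNeZero A (by
    rw [Matrix.det_of_isUpperTriangular fun i j h => hA.2 i j h]
    simp [hA.1]), hA⟩

/-- Two unitriangular matrices agree on the diagonal and the first `i` superdiagonals. -/
def Agree (i : ℕ) (g h : UT n) : Prop :=
  ∀ j k : Fin n, (k : ℕ) ≤ j + i → entry g j k = entry h j k

theorem Agree.refl (i : ℕ) (g : UT n) : Agree i g g := fun _ _ _ => rfl

theorem Agree.symm {i : ℕ} {g h : UT n} (H : Agree i g h) : Agree i h g :=
  fun j k hjk => (H j k hjk).symm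

theorem Agree.trans {i : ℕ} {g h l : UT n} (H : Agree i g h) (H' : Agree i h l) : Agree i g l :=
  fun j k hjk => (H j k hjk).trans (H' j k hjk)

theorem Agree.mul {i : ℕ} {g g' h h' : UT n} (H : Agree i g g') (H' : Agree i h h') :
    Agree i (g * h) (g' * h') := by
  intro j k hjk
  rw [entry_mul, entry_mul]
  refine Finset.sum_congr rfl fun l _ => ?_
  rcases lt_or_ge l j with hl | hl
  · rw [entry_of_lt g hl, entry_of_lt g' hl, zero_mul, zero_mul]
  rcases lt_or_ge k l with hk | hk
  · rw [entry_of_lt h hk, entry_of_lt h' hk, mul_zero, mul_zero]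
  rw [H j l (by omega), H' l k (by omega)]

/-- The subgroup of the unitriangular matrices whose first `i` superdiagonals vanish. -/
def band (n i : ℕ) : Subgroup (UT n) where
  carrier := {g | Agree i g 1}
  mul_mem' {a b} ha hb := by simpa using Agree.mul ha hb
  one_mem' := Agree.refl i 1
  inv_mem' {a} ha := by simpa using ((Agree.refl i a⁻¹).mul ha).symm

theorem mem_band {i : ℕ} {g : UT n} : g ∈ band n i ↔ Agree i g 1 := Iff.rfl

theorem Agree.inv_mul_mem_band {i : ℕ} {g h : UT n} (H : Agree i g h) : g⁻¹ * h ∈ band n i := by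
  simpa [mem_band] using ((Agree.refl i g⁻¹).mul H).symm

/-- In $(g-1)h$, an entry this close to the diagonal receives only the term $l=k$, as `h` has ones
on the diagonal. -/
theorem entry_mul_of_mem_band_left {i : ℕ} {g : UT n} (hg : g ∈ band n i) (h : UT n) {j k : Fin n}
    (hjk : (k : ℕ) ≤ j + (i + 1)) :
    entry (g * h) j k = entry h j k + entry g j k - entry (1 : UT n) j k := by
  have key : ∑ l, (entry g j l - entry (1 : UT n) j l) * entry h l k =
      (entry g j k - entry (1 : UT n) j k) * entry h k k := by
    refine Finset.sum_eq_single k (fun l _ hl => ?_) (by simp)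
    rcases lt_or_gt_of_ne hl with hl | hl
    · rw [hg j l (by omega), sub_self, zero_mul]
    · rw [entry_of_lt h hl, mul_zero]
  simp_rw [sub_mul] at key
  rw [Finset.sum_sub_distrib, ← entry_mul, ← entry_mul, one_mul, entry_self] at key
  linarith

theorem entry_mul_of_mem_band_right {i : ℕ} {g : UT n} (hg : g ∈ band n i) (h : UT n) {j k : Fin n}
    (hjk : (k : ℕ) ≤ j + (i + 1)) :
    entry (h * g) j k = entry h j k + entry g j k - entry (1 : UT n) j k := by
  have key : ∑ l, entry h j l * (entry g l k - entry (1 : UT n) l k) =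
      entry h j j * (entry g j k - entry (1 : UT n) j k) := by
    refine Finset.sum_eq_single j (fun l _ hl => ?_) (by simp)
    rcases lt_or_gt_of_ne hl with hl | hl
    · rw [entry_of_lt h hl, zero_mul]
    · rw [hg l k (by omega), sub_self, mul_zero]
  simp_rw [mul_sub] at key
  rw [Finset.sum_sub_distrib, ← entry_mul, ← entry_mul, mul_one, entry_self] at key
  linarith

/-- Each band is central modulo the next, since both products simply add entries on superdiagonal `i
+ 1`. -/
theorem agree_mul_comm {i : ℕ} {g : UT n} (hg : g ∈ band n i) (h : UT n) :
    Agree (i + 1) (g * h) (h * g) := fun j k hjk => by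
  rw [entry_mul_of_mem_band_left hg h hjk, entry_mul_of_mem_band_right hg h hjk]

theorem lowerCentralSeries_le_band (i : ℕ) :
    Subgroup.lowerCentralSeries (⊤ : Subgroup (UT n)) i ≤ band n i := by
  induction i with
  | zero =>
    intro g _ j k hjk
    rcases eq_or_ne j k with rfl | hne
    · rw [entry_self, entry_self]
    · have h : k < j := by omega
      rw [entry_of_lt g h, entry_of_lt 1 h]
  | succ i ih =>
    rw [Subgroup.lowerCentralSeries_succ, Subgroup.commutator_le]
    intro g hg h _
    have H := (agree_mul_comm (ih hg) h).mul (Agree.refl (i + 1) (h * g)⁻¹)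
    rw [mul_inv_cancel] at H
    rw [mem_band, commutatorElement_def]
    convert H using 1
    group

/-- The matrix with ones on the diagonal, the numbers `c j` on the `m`-th superdiagonal, and zeros
elsewhere. -/
def diagMatrix (n m : ℕ) (c : ℕ → ℝ) : Matrix (Fin n) (Fin n) ℝ := fun j k =>
  if j = k then 1 else if (k : ℕ) = j + m then c j else 0

theorem isUnitriangular_diagMatrix (n m : ℕ) (c : ℕ → ℝ) : IsUnitriangular (diagMatrix n m c) := by
  refine ⟨fun i => by simp [diagMatrix], fun i j h => ?_⟩
  rw [diagMatrix, if_neg h.ne', if_neg (by omega)]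

/-- The unitriangular matrix with the numbers `c j` on the `m`-th superdiagonal and zeros on the
others. -/
noncomputable def diag (n m : ℕ) (c : ℕ → ℝ) : UT n := ofMatrix _ (isUnitriangular_diagMatrix n m c)

theorem entry_diag (m : ℕ) (c : ℕ → ℝ) (j k : Fin n) :
    entry (diag n m c) j k = if j = k then 1 else if (k : ℕ) = j + m then c j else 0 := rfl

theorem diag_mem_band (m : ℕ) (c : ℕ → ℝ) : diag n (m + 1) c ∈ band n m := by
  intro j k hjk
  rw [entry_diag, entry_one]
  split_ifs <;> first | rfl | omega

theorem entry_diag_mul_diag {m m' : ℕ} (hm : m ≠ 0) (hm' : m' ≠ 0) (c c' : ℕ → ℝ) {j k : Fin n}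
    (hjk : (k : ℕ) = j + m + m') :
    entry (diag n m c * diag n m' c') j k = c j * c' (j + m) := by
  rw [entry_mul, Finset.sum_eq_single ⟨j + m, by omega⟩]
  · simp only [entry_diag, Fin.ext_iff]
    rw [if_neg (by omega), if_pos trivial, if_neg (by omega), if_pos hjk]
  · intro l _ hl
    have hl : (l : ℕ) ≠ j + m := fun h => hl (Fin.ext h)
    simp only [entry_diag, Fin.ext_iff]
    rcases eq_or_ne (j : ℕ) l with h | h
    · rw [if_neg (show (l : ℕ) ≠ k by omega), if_neg (show ¬ (k : ℕ) = l + m' by omega), mul_zero]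
    · rw [if_neg h, if_neg hl, zero_mul]
  · simp

/-- Modulo the next band, every element of `band n (m + 1)` is a commutator of an element
of `band n m`. -/
theorem exists_commutator_agree {m : ℕ} {g : UT n} (hg : g ∈ band n (m + 1)) :
    ∃ x ∈ band n m, ∃ y : UT n, Agree (m + 2) ⁅x, y⁆ g := by
  let a : ℕ → ℝ := fun l => if h : l + (m + 2) < n then
    entry g ⟨l, by omega⟩ ⟨l + (m + 2), h⟩ else 0
  -- On superdiagonal `m + 2`, `x * y` has entries `c j` and `y * x` has `c (j + 1)`; the partial
  -- sums solve `c j - c (j + 1) = a j`.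
  let c : ℕ → ℝ := fun j => -∑ l ∈ Finset.range j, a l
  let x := diag n (m + 1) c
  let y := diag n 1 fun _ => 1
  have hx : x ∈ band n m := diag_mem_band m c
  have H : Agree (m + 2) (x * y) (g * (y * x)) := by
    intro j k hjk
    rw [entry_mul_of_mem_band_left hg _ hjk]
    rcases hjk.lt_or_eq with h | h
    · rw [hg j k (by omega), agree_mul_comm hx y j k (by omega)]
      ring
    · have hgjk : entry g j k = a j := by
        have h1 : (j : ℕ) + (m + 2) < n := h ▸ k.2
        simp only [a, dif_pos h1]
        congr 1
        exact Fin.ext h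
      rw [entry_diag_mul_diag (by omega) (by omega) _ _ (show (k : ℕ) = j + (m + 1) + 1 by omega),
        entry_diag_mul_diag (by omega) (by omega) _ _ (show (k : ℕ) = j + 1 + (m + 1) by omega),
        hgjk, entry_one, if_neg (by intro e; subst e; omega)]
      simp only [c, Finset.sum_range_succ]
      ring
  refine ⟨x, hx, y, ?_⟩
  have H' := H.mul (Agree.refl (m + 2) (y * x)⁻¹)
  rw [mul_inv_cancel_right] at H'
  rw [commutatorElement_def]
  convert H' using 1
  group

theorem band_eq_bot {i : ℕ} (hi : n ≤ i + 1) : band n i = ⊥ := by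
  rw [eq_bot_iff]
  intro g hg
  rw [Subgroup.mem_bot]
  ext j k
  exact hg j k (by omega)

theorem band_le_lowerCentralSeries (i : ℕ) :
    band n i ≤ Subgroup.lowerCentralSeries (⊤ : Subgroup (UT n)) i := by
  induction i with
  | zero => exact le_top
  | succ i ih =>
    -- Descending induction on the band, starting from the trivial one: a commutator clears the
    -- lowest nonzero superdiagonal, and the remainder lies in the next band.
    suffices ∀ r m, n ≤ m + 1 + r → i ≤ m →
        band n (m + 1) ≤ Subgroup.lowerCentralSeries (⊤ : Subgroup (UT n)) (i + 1) from
      this n i (by omega) le_rfl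
    intro r
    induction r with
    | zero =>
      intro m hm _
      rw [band_eq_bot (by omega)]
      exact bot_le
    | succ r ihr =>
      intro m hm him g hg
      obtain ⟨x, hx, y, hxy⟩ := exists_commutator_agree hg
      have hx' : x ∈ band n i := fun j k hjk => hx j k (by omega)
      have h := mul_mem (Subgroup.commutator_mem_commutator (ih hx') (Subgroup.mem_top y))
        (ihr (m + 1) (by omega) (by omega) hxy.inv_mul_mem_band)
      rwa [mul_inv_cancel_left] at h

/-- The terms of the lower central series of `U_n(ℝ)`. -/
theorem lowerCentralSeries_eq_band (i : ℕ) :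
    Subgroup.lowerCentralSeries (⊤ : Subgroup (UT n)) i = band n i :=
  le_antisymm (lowerCentralSeries_le_band i) (band_le_lowerCentralSeries i)

instance isNilpotent : Group.IsNilpotent (UT n) :=
  Subgroup.nilpotent_iff_lowerCentralSeries.mpr
    ⟨n, by rw [lowerCentralSeries_eq_band, band_eq_bot (by omega)]⟩

theorem nilpotencyClass_eq : Group.nilpotencyClass (UT n) = n - 1 := by
  refine le_antisymm ?_ ?_
  · rw [← Subgroup.lowerCentralSeries_eq_bot_iff_nilpotencyClass_le, lowerCentralSeries_eq_band,
      band_eq_bot (by omega)]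
  · by_contra! h
    obtain ⟨m, rfl⟩ : ∃ m, n = m + 2 := ⟨n - 2, by omega⟩
    have hbot : Subgroup.lowerCentralSeries (⊤ : Subgroup (UT (m + 2))) m = ⊥ :=
      Subgroup.lowerCentralSeries_eq_bot_iff_nilpotencyClass_le.mpr (by omega)
    -- The elementary matrix with a one in the top right corner is a nontrivial element of the last
    -- band.
    have hmem := diag_mem_band (n := m + 2) m fun _ => 1
    rw [← lowerCentralSeries_eq_band, hbot, Subgroup.mem_bot] at hmem
    have := congrArg (fun g : UT (m + 2) => entry g 0 (Fin.last (m + 1))) hmem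
    simp [entry_diag, entry_one, Fin.ext_iff] at this

end UT

/-! ### Degrees under group homomorphisms -/

section Maps

variable {S G H : Type*} [AddCommSemigroup S] [Group G] [Group H]

theorem DegreeLENat.map (φ : G →* H) {e : ℕ} {f : S → G} (hf : DegreeLENat e f) :
    DegreeLENat e fun t => φ (f t) := by
  induction e generalizing f with
  | zero =>
    obtain ⟨c, hc⟩ := hf
    exact ⟨φ c, fun t => by beta_reduce; rw [hc]⟩
  | succ e ih =>
    intro s
    have h := hf s
    refine ⟨?_, ?_⟩
    · convert ih h.1 using 2 with t
      simp [leftDiff]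
    · convert ih h.2 using 2 with t
      simp [rightDiff]

theorem DegreeLE.map (φ : G →* H) {e : WithBot ℕ} {f : S → G} (hf : DegreeLE f e) :
    DegreeLE (fun t => φ (f t)) e := by
  cases e with
  | bot => exact fun t => by beta_reduce; rw [show f t = 1 from hf t, map_one]
  | coe e => exact DegreeLENat.map φ hf

theorem DegreeLENat.of_map {φ : G →* H} (hφ : Function.Injective φ) {e : ℕ} {f : S → G} [Nonempty S]
    (hf : DegreeLENat e fun t => φ (f t)) : DegreeLENat e f := by
  induction e generalizing f with
  | zero =>
    obtain ⟨c, hc⟩ := hf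
    obtain ⟨t₀⟩ := ‹Nonempty S›
    exact ⟨f t₀, fun t => hφ ((hc t).trans (hc t₀).symm)⟩
  | succ e ih =>
    intro s
    have h := hf s
    refine ⟨ih ?_, ih ?_⟩
    · convert h.1 using 2 with t
      simp [leftDiff]
    · convert h.2 using 2 with t
      simp [rightDiff]

theorem DegreeLE.of_map {φ : G →* H} (hφ : Function.Injective φ) {e : WithBot ℕ} {f : S → G}
    [Nonempty S] (hf : DegreeLE (fun t => φ (f t)) e) : DegreeLE f e := by
  cases e with
  | bot => exact fun t => hφ ((hf t).trans (map_one φ).symm)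
  | coe e => exact DegreeLENat.of_map hφ hf

theorem DegreeLE.exists_hasDegree {e : WithBot ℕ} {f : S → G} (hf : DegreeLE f e) :
    ∃ d, HasDegree f d := by
  obtain ⟨d, hd, hmin⟩ := wellFounded_lt.has_min {e | DegreeLE f e} ⟨e, hf⟩
  exact ⟨d, hd, fun x hx => not_lt.mp (hmin x hx)⟩

end Maps

/-! ### Real-valued polynomial maps and strict degree bounds -/

section Scalar

variable {S : Type*} [AddCommMonoid S]

/-- The real-valued map `g` is a polynomial map of degree less than `e`. -/
def DegreeLT : ℕ → (S → ℝ) → Prop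
  | 0, g => ∀ t, g t = 0
  | e + 1, g => ∀ s, DegreeLT e fun t => g (s + t) - g t

namespace DegreeLT

theorem zero_map (e : ℕ) : DegreeLT e fun _ : S => (0 : ℝ) := by
  induction e with
  | zero => exact fun _ => rfl
  | succ e ih => exact fun s => by simpa using ih

theorem of_zero {g : S → ℝ} (h : DegreeLT 0 g) (e : ℕ) : DegreeLT e g := by
  rw [show g = fun _ => 0 from funext h]
  exact zero_map e

theorem succ {e : ℕ} {g : S → ℝ} (h : DegreeLT e g) : DegreeLT (e + 1) g := by
  induction e generalizing g with
  | zero => exact h.of_zero 1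
  | succ e ih => exact fun s => ih (h s)

theorem mono {a b : ℕ} (hab : a ≤ b) {g : S → ℝ} (h : DegreeLT a g) : DegreeLT b g := by
  induction hab with
  | refl => exact h
  | step _ ih => exact ih.succ

theorem diff {e : ℕ} {g : S → ℝ} (h : DegreeLT e g) (s : S) :
    DegreeLT (e - 1) fun t => g (s + t) - g t := by
  cases e with
  | zero => exact fun t => by beta_reduce; rw [show g (s + t) = 0 from h _, show g t = 0 from h _, sub_zero]
  | succ e => exact h s

theorem add {e : ℕ} {g h : S → ℝ} (hg : DegreeLT e g) (hh : DegreeLT e h) :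
    DegreeLT e fun t => g t + h t := by
  induction e generalizing g h with
  | zero => exact fun t => by beta_reduce; rw [show g t = 0 from hg t, show h t = 0 from hh t, add_zero]
  | succ e ih =>
    intro s
    convert ih (hg s) (hh s) using 2 with t
    ring

theorem neg {e : ℕ} {g : S → ℝ} (hg : DegreeLT e g) : DegreeLT e fun t => -g t := by
  induction e generalizing g with
  | zero => exact fun t => by beta_reduce; rw [show g t = 0 from hg t, neg_zero]
  | succ e ih =>
    intro s
    convert ih (hg s) using 2 with t
    ring

theorem sum {ι : Type*} {e : ℕ} {g : ι → S → ℝ} (s : Finset ι)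
    (hg : ∀ l ∈ s, DegreeLT e (g l)) : DegreeLT e fun t => ∑ l ∈ s, g l t := by
  classical
  induction s using Finset.induction_on with
  | empty => simpa using zero_map e
  | insert a s ha ih =>
    simp_rw [Finset.sum_insert ha]
    exact (hg a (Finset.mem_insert_self a s)).add
      (ih fun l hl => hg l (Finset.mem_insert_of_mem hl))

theorem translate {e : ℕ} {g : S → ℝ} (hg : DegreeLT e g) (r : S) :
    DegreeLT e fun t => g (r + t) := by
  induction e generalizing g with
  | zero => exact fun t => hg _
  | succ e ih =>
    intro s
    convert ih (hg s) using 2 with t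
    rw [add_left_comm]

/-- Leibniz rule $\Delta_s(gh)=\Delta_s g\cdot h(s+\cdot)+g\cdot\Delta_s h$ and induction on `a +
b`. -/
theorem mul_succ {a b : ℕ} {g h : S → ℝ} (hg : DegreeLT (a + 1) g) (hh : DegreeLT (b + 1) h) :
    DegreeLT (a + b + 1) fun t => g t * h t := by
  induction hm : a + b generalizing a b g h with
  | zero =>
    obtain ⟨rfl, rfl⟩ : a = 0 ∧ b = 0 := by omega
    intro s t
    beta_reduce
    rw [sub_eq_zero.mp (hg s t), sub_eq_zero.mp (hh s t), sub_self]
  | succ m ih =>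
    intro s
    have key : DegreeLT (m + 1) fun t => (g (s + t) - g t) * h (s + t) + g t * (h (s + t) - h t) := by
      refine add ?_ ?_
      · cases a with
        | zero => exact of_zero (fun t => by rw [show g (s + t) - g t = 0 from hg s t, zero_mul]) _
        | succ a => exact ih (hg s) (hh.translate s) (by omega)
      · cases b with
        | zero => exact of_zero (fun t => by rw [show h (s + t) - h t = 0 from hh s t, mul_zero]) _
        | succ b => exact ih hg (hh s) (by omega)
    convert key using 2 with t
    ring

/-- A bound of `0` makes the product vanish, so the inequality is needed only for nonzero bounds.
This is the shape of `Superadditive`. -/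
theorem mul {a b c : ℕ} {g h : S → ℝ} (hg : DegreeLT a g) (hh : DegreeLT b h)
    (hc : a ≠ 0 → b ≠ 0 → a + b ≤ c + 1) : DegreeLT c fun t => g t * h t := by
  cases a with
  | zero => exact of_zero (fun t => by rw [show g t = 0 from hg t, zero_mul]) _
  | succ a =>
    cases b with
    | zero => exact of_zero (fun t => by rw [show h t = 0 from hh t, mul_zero]) _
    | succ b => exact (hg.mul_succ hh).mono (by have := hc (by omega) (by omega); omega)

theorem eq_of_one {g : S → ℝ} (hg : DegreeLT 1 g) (t : S) : g t = g 0 := by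
  have h : g (t + 0) - g 0 = 0 := hg t 0
  rwa [add_zero, sub_eq_zero] at h

end DegreeLT

/-- The least `w` such that `e < w`, for `e` in `{-∞} ∪ ℕ`. -/
def weight : WithBot ℕ → ℕ
  | none => 0
  | some e => e + 1

theorem weight_bot : weight ⊥ = 0 := rfl

theorem weight_mono : Monotone weight := by
  intro x y h
  cases x with
  | bot => exact Nat.zero_le _
  | coe x =>
    cases y with
    | bot => simp at h
    | coe y => exact Nat.succ_le_succ (WithBot.coe_le_coe.mp h)

theorem weight_add {x y : WithBot ℕ} (hx : weight x ≠ 0) (hy : weight y ≠ 0) :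
    weight x + weight y = weight (x + y) + 1 := by
  cases x with
  | bot => exact absurd weight_bot hx
  | coe x =>
    cases y with
    | bot => exact absurd weight_bot hy
    | coe y =>
      change (x + 1) + (y + 1) = (x + y + 1) + 1
      omega

theorem DegreeLENat.degreeLT {e : ℕ} {g : S → ℝ} (h : DegreeLENat e (toMul g)) :
    DegreeLT (e + 1) g := by
  induction e generalizing g with
  | zero =>
    obtain ⟨c, hc⟩ := h
    have hc' : ∀ t, g t = Multiplicative.toAdd c := hc
    exact fun s t => by simp [hc']
  | succ e ih =>
    refine fun s => ih ?_
    convert (h s).1 using 1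
    funext t
    simp [leftDiff, toMul, div_eq_mul_inv]

theorem DegreeLE.degreeLT {e : WithBot ℕ} {g : S → ℝ} (h : DegreeLE (toMul g) e) :
    DegreeLT (weight e) g := by
  cases e with
  | bot => exact h
  | coe e => exact DegreeLENat.degreeLT h

end Scalar

/-! ### From degrees of entries to degrees of matrix-valued maps -/

section Matrices

open UT

variable {n : ℕ}

theorem UT.entry_mul_inv (a b : UT n) {j k : Fin n} (hjk : j < k) :
    entry (a * b⁻¹) j k =
      ∑ l ∈ Finset.Ioc j k, (entry a j l - entry b j l) * entry b⁻¹ l k := by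
  have key : ∑ l, (entry a j l - entry b j l) * entry b⁻¹ l k = entry (a * b⁻¹) j k := by
    simp_rw [sub_mul]
    rw [Finset.sum_sub_distrib, ← entry_mul, ← entry_mul, mul_inv_cancel, entry_one,
      if_neg hjk.ne, sub_zero]
  rw [← key]
  refine (Finset.sum_subset (Finset.subset_univ _) fun l _ hl => ?_).symm
  rw [Finset.mem_Ioc, not_and_or, not_lt, not_le] at hl
  rcases hl with hl | hl
  · rcases hl.lt_or_eq with h | rfl
    · rw [entry_of_lt a h, entry_of_lt b h, sub_self, zero_mul]
    · rw [entry_self, entry_self, sub_self, zero_mul]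
  · rw [entry_of_lt _ hl, mul_zero]

theorem UT.entry_inv_mul (a b : UT n) {j k : Fin n} (hjk : j < k) :
    entry (b⁻¹ * a) j k =
      ∑ l ∈ Finset.Ico j k, entry b⁻¹ j l * (entry a l k - entry b l k) := by
  have key : ∑ l, entry b⁻¹ j l * (entry a l k - entry b l k) = entry (b⁻¹ * a) j k := by
    simp_rw [mul_sub]
    rw [Finset.sum_sub_distrib, ← entry_mul, ← entry_mul, inv_mul_cancel, entry_one,
      if_neg hjk.ne, sub_zero]
  rw [← key]
  refine (Finset.sum_subset (Finset.subset_univ _) fun l _ hl => ?_).symm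
  rw [Finset.mem_Ico, not_and_or, not_lt, not_le] at hl
  rcases hl with hl | hl
  · rw [entry_of_lt _ hl, zero_mul]
  · rcases hl.lt_or_eq with h | rfl
    · rw [entry_of_lt a h, entry_of_lt b h, sub_self, mul_zero]
    · rw [entry_self, entry_self, sub_self, mul_zero]

/-- Strict degree bounds for the entries on the first `i` superdiagonals that are compatible with
matrix multiplication. -/
def Superadditive (i : ℕ) (w : Fin n → Fin n → ℕ) : Prop :=
  ∀ j l k : Fin n, j < l → l < k → (k : ℕ) ≤ j + i → w j l ≠ 0 → w l k ≠ 0 →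
    w j l + w l k ≤ w j k + 1

variable {S : Type*} [AddCommMonoid S]

/-- The entries of `f` on the first `i` superdiagonals have degrees less than those of `w`. -/
def EntriesLT (i : ℕ) (w : Fin n → Fin n → ℕ) (f : S → UT n) : Prop :=
  ∀ j k : Fin n, j < k → (k : ℕ) ≤ j + i → DegreeLT (w j k) fun t => entry (f t) j k

theorem Superadditive.pred {i : ℕ} {w : Fin n → Fin n → ℕ} (hw : Superadditive i w) :
    Superadditive i fun j k => w j k - 1 := by
  intro j l k hjl hlk hi h h'
  dsimp only at h h' ⊢
  have := hw j l k hjl hlk hi (by omega) (by omega)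
  omega

/-- The identity $ff^{-1}=1$ expresses an entry of the inverse through those closer to the diagonal;
the induction runs over $k-j$. -/
theorem EntriesLT.inv {i : ℕ} {w : Fin n → Fin n → ℕ} (hw : Superadditive i w) {f : S → UT n}
    (hf : EntriesLT i w f) : EntriesLT i w fun t => (f t)⁻¹ := by
  suffices ∀ r, ∀ j k : Fin n, j < k → (k : ℕ) ≤ j + i → (k : ℕ) ≤ j + r →
      DegreeLT (w j k) fun t => entry (f t)⁻¹ j k from
    fun j k hjk hi => this k j k hjk hi (by omega)
  intro r
  induction r with
  | zero => intro j k hjk _ _; omega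
  | succ r ih =>
    intro j k hjk hi hr
    have key : ∀ t, entry (f t)⁻¹ j k =
        ∑ l ∈ Finset.Ioc j k, (-entry (f t) j l) * entry (f t)⁻¹ l k := by
      intro t
      rw [← one_mul (f t)⁻¹, entry_mul_inv _ _ hjk, one_mul]
      refine Finset.sum_congr rfl fun l hl => ?_
      rw [entry_one, if_neg (Finset.mem_Ioc.mp hl).1.ne, zero_sub]
    simp_rw [key]
    refine DegreeLT.sum _ fun l hl => ?_
    obtain ⟨hjl, hlk⟩ := Finset.mem_Ioc.mp hl
    rcases hlk.lt_or_eq with hlk | rfl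
    · exact (hf j l hjl (by omega)).neg.mul (ih l k hlk (by omega) (by omega))
        (hw j l k hjl hlk hi)
    · simp_rw [entry_self, mul_one]
      exact (hf j l hjl hi).neg

/-- Since $ab^{-1}-1=(a-b)b^{-1}$, every term contains one differenced entry, which gains one
degree. -/
theorem EntriesLT.leftDiff {i : ℕ} {w : Fin n → Fin n → ℕ} (hw : Superadditive i w)
    {f : S → UT n} (hf : EntriesLT i w f) (s : S) :
    EntriesLT i (fun j k => w j k - 1) (leftDiff s f) := by
  intro j k hjk hi
  simp_rw [PolyMap.leftDiff, entry_mul_inv _ _ hjk]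
  refine DegreeLT.sum _ fun l hl => ?_
  obtain ⟨hjl, hlk⟩ := Finset.mem_Ioc.mp hl
  rcases hlk.lt_or_eq with hlk | rfl
  · refine ((hf j l hjl (by omega)).diff s).mul (hf.inv hw l k hlk (by omega)) fun h h' => ?_
    have := hw j l k hjl hlk hi (by omega) h'
    omega
  · simp_rw [entry_self, mul_one]
    exact (hf j l hjl hi).diff s

theorem EntriesLT.rightDiff {i : ℕ} {w : Fin n → Fin n → ℕ} (hw : Superadditive i w)
    {f : S → UT n} (hf : EntriesLT i w f) (s : S) :
    EntriesLT i (fun j k => w j k - 1) (rightDiff s f) := by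
  intro j k hjk hi
  simp_rw [PolyMap.rightDiff, entry_inv_mul _ _ hjk]
  refine DegreeLT.sum _ fun l hl => ?_
  obtain ⟨hjl, hlk⟩ := Finset.mem_Ico.mp hl
  rcases hjl.lt_or_eq with hjl | rfl
  · refine (hf.inv hw j l hjl (by omega)).mul ((hf l k hlk (by omega)).diff s) fun h h' => ?_
    have := hw j l k hjl hlk hi h (by omega)
    omega
  · simp_rw [entry_self, one_mul]
    exact (hf j k hlk hi).diff s

theorem UT.Agree.mk_eq {i : ℕ} {g h : UT n} (H : Agree i g h) :
    (g : UT n ⧸ Subgroup.lowerCentralSeries (⊤ : Subgroup (UT n)) i) = h := by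
  rw [QuotientGroup.eq, lowerCentralSeries_eq_band]
  exact H.inv_mul_mem_band

theorem UT.agree_of_forall_lt {i : ℕ} {g h : UT n}
    (H : ∀ j k : Fin n, j < k → (k : ℕ) ≤ j + i → entry g j k = entry h j k) : Agree i g h := by
  intro j k hi
  rcases lt_trichotomy j k with h' | rfl | h'
  · exact H j k h' hi
  · rw [entry_self, entry_self]
  · rw [entry_of_lt g h', entry_of_lt h h']

/-- Differences satisfy the same hypotheses with `w - 1`; once all weights are at most one, the
relevant entries are constant. -/
theorem EntriesLT.degreeLENat_modLC {i m : ℕ} {w : Fin n → Fin n → ℕ} (hw : Superadditive i w)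
    {f : S → UT n} (hf : EntriesLT i w f)
    (hm : ∀ j k : Fin n, j < k → (k : ℕ) ≤ j + i → w j k ≤ m + 1) :
    DegreeLENat m (modLC f i) := by
  induction m generalizing w f with
  | zero =>
    refine ⟨modLC f i 0, fun t => Agree.mk_eq (agree_of_forall_lt fun j k hjk hi => ?_)⟩
    exact ((hf j k hjk hi).mono (hm j k hjk hi)).eq_of_one t
  | succ m ih =>
    intro s
    have hm' : ∀ j k : Fin n, j < k → (k : ℕ) ≤ j + i → w j k - 1 ≤ m + 1 :=
      fun j k hjk hi => by have := hm j k hjk hi; omega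
    exact ⟨ih hw.pred (hf.leftDiff hw s) hm', ih hw.pred (hf.rightDiff hw s) hm'⟩

theorem EntriesLT.degreeLE_modLC {i : ℕ} {M : WithBot ℕ} {w : Fin n → Fin n → ℕ}
    (hw : Superadditive i w) {f : S → UT n} (hf : EntriesLT i w f)
    (hM : ∀ j k : Fin n, j < k → (k : ℕ) ≤ j + i → w j k ≤ weight M) :
    DegreeLE (modLC f i) M := by
  cases M with
  | bot =>
    refine fun t => Agree.mk_eq (h := 1) (agree_of_forall_lt fun j k hjk hi => ?_)
    rw [entry_one, if_neg hjk.ne]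
    exact (hf j k hjk hi).mono (hM j k hjk hi) t
  | coe m => exact hf.degreeLENat_modLC hw hM

/-- An entry on the first superdiagonal, as a homomorphism. -/
noncomputable def UT.superdiagonalHom (a b : Fin n) (hab : (b : ℕ) = a + 1) :
    UT n →* Multiplicative ℝ where
  toFun g := Multiplicative.ofAdd (entry g a b)
  map_one' := by rw [entry_one, if_neg (by intro h; subst h; omega), ofAdd_zero]
  map_mul' g h := by
    have hg : g ∈ band n 0 := by
      rw [← lowerCentralSeries_eq_band]
      exact Subgroup.mem_top g
    rw [entry_mul_of_mem_band_left hg h (by omega), entry_one,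
      if_neg (by intro h; subst h; omega), sub_zero, add_comm, ofAdd_add]

theorem DegreeLE.superdiagonal_of_modLC {f : S → UT n} {e : WithBot ℕ}
    (hf : DegreeLE (modLC f 1) e) {a b : Fin n} (hab : (b : ℕ) = a + 1) :
    DegreeLE (toMul fun t => entry (f t) a b) e := by
  refine hf.map (QuotientGroup.lift _ (superdiagonalHom a b hab) fun g hg => ?_)
  rw [lowerCentralSeries_eq_band] at hg
  have h : entry g a b = 0 := by
    rw [hg a b hab.le, entry_one, if_neg (by intro h; subst h; omega)]
  exact congrArg Multiplicative.ofAdd h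

theorem DegreeLE.modLC_of_le {G : Type*} [Group G] {f : S → G} {e : WithBot ℕ} {i i' : ℕ}
    (hi : i' ≤ i) (hf : DegreeLE (modLC f i) e) : DegreeLE (modLC f i') e :=
  hf.map (QuotientGroup.map _ _ (MonoidHom.id G)
    (Subgroup.lowerCentralSeries_antitone (⊤ : Subgroup G) hi))

theorem degreeLE_modLC_iff {G : Type*} [Group G] {f : S → G} {e : WithBot ℕ} {i : ℕ}
    (hi : Subgroup.lowerCentralSeries (⊤ : Subgroup G) i = ⊥) :
    DegreeLE (modLC f i) e ↔ DegreeLE f e := by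
  have hinj : Function.Injective
      (QuotientGroup.mk' (Subgroup.lowerCentralSeries (⊤ : Subgroup G) i)) := by
    rw [← MonoidHom.ker_eq_bot_iff, QuotientGroup.ker_mk', hi]
  exact ⟨fun h => DegreeLE.of_map hinj h, fun h => h.map (QuotientGroup.mk' _)⟩

end Matrices

/-! ### Chain sums and the resulting bounds -/

section ChainBounds

variable {n : ℕ}

/-- `x` is the sum of `d` along some chain `j < ⋯ < k`. -/
inductive IsStrictChainSum (d : Fin n → Fin n → WithBot ℕ) : Fin n → Fin n → WithBot ℕ → Prop
  | nil (j : Fin n) : IsStrictChainSum d j j 0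
  | cons {j l k : Fin n} {y : WithBot ℕ} (hjl : j < l) (h : IsStrictChainSum d l k y) :
      IsStrictChainSum d j k (d j l + y)

namespace IsStrictChainSum

variable {d : Fin n → Fin n → WithBot ℕ} {j k l : Fin n} {x y : WithBot ℕ}

theorem le (h : IsStrictChainSum d j k x) : j ≤ k := by
  induction h with
  | nil j => exact le_rfl
  | cons hjl _ ih => exact hjl.le.trans ih

theorem single (d : Fin n → Fin n → WithBot ℕ) (h : j < k) : IsStrictChainSum d j k (d j k) := by
  simpa using cons (d := d) h (nil k)

theorem append (h : IsStrictChainSum d j l x) (h' : IsStrictChainSum d l k y) :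
    IsStrictChainSum d j k (x + y) := by
  induction h with
  | nil j => simpa using h'
  | cons hjl _ ih =>
    rw [add_assoc]
    exact cons hjl (ih h')

theorem eq_zero (h : IsStrictChainSum d j j x) : x = 0 := by
  cases h with
  | nil => rfl
  | cons hjl h => exact absurd hjl h.le.not_gt

theorem eq_of_succ (h : IsStrictChainSum d j k x) (hjk : (k : ℕ) = j + 1) : x = d j k := by
  cases h with
  | nil => omega
  | @cons _ l _ y hjl h =>
    have hlk := h.le
    obtain rfl : l = k := by omega
    rw [h.eq_zero, add_zero]

/-- A strict chain has at most $k-j$ steps; repeating its endpoint pads it to `m` steps at no cost.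
-/
theorem exists_chain (h : IsStrictChainSum d j k x) {m : ℕ} (hm : (k : ℕ) ≤ j + m) :
    ∃ c : Fin (m + 1) → Fin n, Monotone c ∧ c 0 = j ∧ c (Fin.last m) = k ∧ x = chainSum d c := by
  induction h generalizing m with
  | nil j => exact ⟨fun _ => j, monotone_const, rfl, rfl, by simp [chainSum]⟩
  | @cons j l k y hjl h ih =>
    have hlk := h.le
    obtain ⟨m, rfl⟩ : ∃ m', m = m' + 1 := ⟨m - 1, by omega⟩
    obtain ⟨c, hc, hc0, hcl, rfl⟩ := ih (m := m) (by omega)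
    refine ⟨Fin.cons j c, ?_, rfl, ?_, ?_⟩
    · rw [Fin.monotone_iff_le_succ]
      intro i
      cases i using Fin.cases with
      | zero => simpa [hc0] using hjl.le
      | succ i => simpa [← Fin.succ_castSucc] using hc i.castSucc_lt_succ.le
    · rw [← Fin.succ_last, Fin.cons_succ, hcl]
    · simp [chainSum, Fin.sum_univ_succ, hc0, hjl.ne]

theorem finite (d : Fin n → Fin n → WithBot ℕ) (j k : Fin n) :
    {x | IsStrictChainSum d j k x}.Finite := by
  refine (Set.finite_range fun c : Fin (n + 1) → Fin n => chainSum d c).subset fun x hx => ?_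
  obtain ⟨c, -, -, -, rfl⟩ := exists_chain hx (m := n) (by omega)
  exact ⟨c, rfl⟩

/-- Superdiagonal degrees are nonnegative here, so appending or prepending unit steps never
decreases the sum; `r` counts the missing steps. -/
theorem exists_extension (hd : ⊥ ∉ superdiagonal d) {i : ℕ} (hi : i ≤ n - 1) {r : ℕ}
    (h : IsStrictChainSum d j k x) (hjk : j < k) (hr : (k : ℕ) + r = j + i) :
    ∃ (j' k' : Fin n) (x' : WithBot ℕ), IsStrictChainSum d j' k' x' ∧ (k' : ℕ) = j' + i ∧ x ≤ x' := by
  have hnonneg : ∀ a b : Fin n, (b : ℕ) = a + 1 → 0 ≤ d a b := by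
    intro a b hab
    have hne : d a b ≠ ⊥ := fun e => hd ⟨a, b, hab, e.symm⟩
    cases hdab : d a b with
    | bot => exact absurd hdab hne
    | coe e => exact WithBot.coe_le_coe.mpr (Nat.zero_le e)
  induction r generalizing j k x with
  | zero => exact ⟨j, k, x, h, hr, le_rfl⟩
  | succ r ih =>
    by_cases hk : (k : ℕ) + 1 < n
    · have hlt : k < ⟨k + 1, hk⟩ := Fin.lt_def.mpr (Nat.lt_succ_self _)
      obtain ⟨j', k', x', h', hi', hx'⟩ :=
        ih (h.append (single d hlt)) (hjk.trans hlt) (by simp only; omega)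
      exact ⟨j', k', x', h', hi', (le_add_of_nonneg_right (hnonneg _ _ rfl)).trans hx'⟩
    -- With `k` at the right end, `i ≤ n - 1` leaves room on the left.
    · have hj : ((⟨j - 1, by omega⟩ : Fin n) : ℕ) + 1 = j := by simp only; omega
      have hlt : (⟨j - 1, by omega⟩ : Fin n) < j := by rw [Fin.lt_def]; omega
      obtain ⟨j', k', x', h', hi', hx'⟩ :=
        ih ((single d hlt).append h) (hlt.trans hjk) (by omega)
      exact ⟨j', k', x', h', hi', (le_add_of_nonneg_left (hnonneg _ _ hj.symm)).trans hx'⟩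

end IsStrictChainSum

theorem exists_isGreatest_of_finite {α : Type*} [LinearOrder α] {s : Set α} (hs : s.Finite)
    (hne : s.Nonempty) : ∃ M, IsGreatest s M := by
  obtain ⟨M, hM, h⟩ := Set.exists_max_image s id hs hne
  exact ⟨M, hM, h⟩

variable {d : Fin n → Fin n → WithBot ℕ}

theorem exists_isGreatest_superdiagonal (hn : 2 ≤ n) : ∃ M, IsGreatest (superdiagonal d) M := by
  refine exists_isGreatest_of_finite
    ((Set.finite_range fun p : Fin n × Fin n => d p.1 p.2).subset ?_)
    ⟨_, ⟨0, by omega⟩, ⟨1, by omega⟩, rfl, rfl⟩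
  rintro x ⟨a, b, -, rfl⟩
  exact ⟨(a, b), rfl⟩

theorem exists_isGreatest_chainSums {i : ℕ} (hi : i + 1 ≤ n) :
    ∃ M, IsGreatest (chainSums d i) M := by
  refine exists_isGreatest_of_finite
    ((Set.finite_range fun k : Fin (i + 1) → Fin n => chainSum d k).subset ?_)
    ⟨_, Fin.castLE hi, (Fin.strictMono_castLE hi).monotone, by simp, rfl⟩
  rintro x ⟨k, -, -, rfl⟩
  exact ⟨k, rfl⟩

theorem exists_isGreatest_shortChainSums {i : ℕ} (hi : 1 ≤ i) (hin : i + 1 ≤ n) :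
    ∃ M, IsGreatest (shortChainSums d i) M := by
  refine exists_isGreatest_of_finite
    ((Set.finite_range fun k : Fin (i + 1) → Fin n => chainSum d k).subset ?_)
    ⟨_, Fin.castLE hin, (Fin.strictMono_castLE hin).monotone, ?_, by simp, rfl⟩
  · rintro x ⟨k, -, -, -, rfl⟩
    exact ⟨k, rfl⟩
  · exact Fin.strictMono_castLE hin (by rw [Fin.lt_def]; simpa using Nat.lt_of_succ_le hi)

variable {S : Type*} [AddCommMonoid S]

theorem degreeLE_modLC_of_chainSums_le {f : S → UT n}
    (hdeg : ∀ j k : Fin n, j < k → HasDegree (toMul fun t => UT.entry (f t) j k) (d j k))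
    {i : ℕ} {M : WithBot ℕ}
    (hM : ∀ j k : Fin n, j < k → (k : ℕ) ≤ j + i → ∀ x, IsStrictChainSum d j k x → x ≤ M) :
    DegreeLE (modLC f i) M := by
  have hex : ∀ j k : Fin n, ∃ D, j < k → IsGreatest {x | IsStrictChainSum d j k x} D := by
    intro j k
    by_cases hjk : j < k
    · obtain ⟨D, hD⟩ := exists_isGreatest_of_finite (IsStrictChainSum.finite d j k)
        ⟨_, IsStrictChainSum.single d hjk⟩
      exact ⟨D, fun _ => hD⟩
    · exact ⟨0, fun h => absurd h hjk⟩
  choose D hD using hex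
  refine EntriesLT.degreeLE_modLC (w := fun j k => weight (D j k)) ?_ ?_ ?_
  -- Concatenating optimal chains gives superadditivity; the `+ 1` arises because each weight
  -- exceeds its degree by one.
  · intro j l k hjl hlk _ h h'
    rw [weight_add h h']
    exact Nat.succ_le_succ (weight_mono ((hD j k (hjl.trans hlk)).2
      ((hD j l hjl).1.append (hD l k hlk).1)))
  · intro j k hjk _
    exact (hdeg j k hjk).1.degreeLT.mono
      (weight_mono ((hD j k hjk).2 (IsStrictChainSum.single d hjk)))
  · exact fun j k hjk hi => weight_mono (hM j k hjk hi _ (hD j k hjk).1)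

theorem degreeLE_modLC_of_isGreatest_shortChainSums {f : S → UT n}
    (hdeg : ∀ j k : Fin n, j < k → HasDegree (toMul fun t => UT.entry (f t) j k) (d j k))
    {i : ℕ} {M : WithBot ℕ} (hM : IsGreatest (shortChainSums d i) M) :
    DegreeLE (modLC f i) M := by
  refine degreeLE_modLC_of_chainSums_le hdeg fun j k hjk hi x hx => ?_
  obtain ⟨c, hc, rfl, rfl, rfl⟩ := hx.exists_chain hi
  exact hM.2 ⟨c, hc, hjk, hi, rfl⟩

theorem degreeLE_modLC_of_isGreatest_chainSums {f : S → UT n}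
    (hdeg : ∀ j k : Fin n, j < k → HasDegree (toMul fun t => UT.entry (f t) j k) (d j k))
    (hd : ⊥ ∉ superdiagonal d) {i : ℕ} (hin : i ≤ n - 1) {M : WithBot ℕ}
    (hM : IsGreatest (chainSums d i) M) : DegreeLE (modLC f i) M := by
  refine degreeLE_modLC_of_chainSums_le hdeg fun j k hjk hi x hx => ?_
  obtain ⟨j', k', x', hx', hi', hle⟩ :=
    hx.exists_extension hd hin hjk (r := j + i - k) (by omega)
  obtain ⟨c, hc, rfl, rfl, rfl⟩ := hx'.exists_chain hi'.le
  exact hle.trans (hM.2 ⟨c, hc, hi', rfl⟩)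

/-- Strict chains between neighbours have a single step, which gives the upper bound; projecting to
superdiagonal entries gives the lower one. -/
theorem isGreatest_superdiagonal_of_hasDegree {f : S → UT n} (hn : 2 ≤ n)
    (hdeg : ∀ j k : Fin n, j < k → HasDegree (toMul fun t => UT.entry (f t) j k) (d j k))
    {δ : WithBot ℕ} (hδ : HasDegree (modLC f 1) δ) : IsGreatest (superdiagonal d) δ := by
  obtain ⟨M, hM⟩ := exists_isGreatest_superdiagonal (d := d) hn
  have hle : δ ≤ M := hδ.2 <| degreeLE_modLC_of_chainSums_le hdeg fun j k hjk hi x hx => by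
    have hk : (k : ℕ) = j + 1 := by omega
    rw [hx.eq_of_succ hk]
    exact hM.2 ⟨j, k, hk, rfl⟩
  have hge : M ≤ δ := by
    obtain ⟨a, b, hab, rfl⟩ := hM.1
    exact (hdeg a b (by omega)).2 (DegreeLE.superdiagonal_of_modLC hδ.1 hab)
  rwa [le_antisymm hle hge]

end ChainBounds

end PolyMap

theorem mainTheorem8 (N n : ℕ) (hn : 2 ≤ n)
    (f : (Fin N → ℝ≥0) → PolyMap.UT n) (d : Fin n → Fin n → WithBot ℕ)
    (hcont : ∀ i j : Fin n, i < j → Continuous fun t => PolyMap.UT.entry (f t) i j)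
    (hdeg : ∀ i j : Fin n, i < j →
      PolyMap.HasDegree (PolyMap.toMul fun t => PolyMap.UT.entry (f t) i j) (d i j)) :
    Group.IsNilpotent (PolyMap.UT n) ∧ Group.nilpotencyClass (PolyMap.UT n) = n - 1 ∧
    PolyMap.IsPolynomialMap f ∧ (∃ δ : ℕ → WithBot ℕ, PolyMap.IsLCDegree f δ) ∧
    ∀ δ : ℕ → WithBot ℕ, PolyMap.IsLCDegree f δ →
      IsGreatest (PolyMap.superdiagonal d) (δ 1) ∧
      (∀ i, 2 ≤ i → i ≤ n - 1 →
        δ (i - 1) ≤ δ i ∧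
        (∃ M, IsGreatest (PolyMap.shortChainSums d i) M ∧ δ i ≤ M) ∧
        (⊥ ∉ PolyMap.superdiagonal d →
          ∃ M, IsGreatest (PolyMap.chainSums d i) M ∧ δ i ≤ M)) ∧
      PolyMap.HasDegree f (δ (n - 1)) ∧
      (∃ M, IsGreatest (PolyMap.shortChainSums d (n - 1)) M ∧ δ (n - 1) ≤ M) ∧
      (⊥ ∉ PolyMap.superdiagonal d →
        ∃ M, IsGreatest (PolyMap.chainSums d (n - 1)) M ∧ δ (n - 1) ≤ M) := by

  have hclass : Group.nilpotencyClass (PolyMap.UT n) = n - 1 := PolyMap.UT.nilpotencyClass_eq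
  have hlast := Subgroup.lowerCentralSeries_nilpotencyClass (G := PolyMap.UT n)
  rw [hclass] at hlast
  have hpoly : ∀ i, 1 ≤ i → i ≤ n - 1 →
      ∃ M, IsGreatest (PolyMap.shortChainSums d i) M ∧ PolyMap.DegreeLE (PolyMap.modLC f i) M := by
    intro i hi hin
    obtain ⟨M, hM⟩ := PolyMap.exists_isGreatest_shortChainSums (d := d) hi (by omega)
    exact ⟨M, hM, PolyMap.degreeLE_modLC_of_isGreatest_shortChainSums hdeg hM⟩
  refine ⟨PolyMap.UT.isNilpotent, hclass, ?_, ?_, fun δ hδ => ?_⟩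
  · obtain ⟨M, -, hM⟩ := hpoly (n - 1) (by omega) le_rfl
    exact ⟨M, (PolyMap.degreeLE_modLC_iff hlast).mp hM⟩
  · have hex : ∀ i, ∃ e, 1 ≤ i → i ≤ n - 1 → PolyMap.HasDegree (PolyMap.modLC f i) e := by
      intro i
      by_cases hi : 1 ≤ i ∧ i ≤ n - 1
      · obtain ⟨M, -, hM⟩ := hpoly i hi.1 hi.2
        obtain ⟨e, he⟩ := hM.exists_hasDegree
        exact ⟨e, fun _ _ => he⟩
      · exact ⟨0, fun h h' => absurd ⟨h, h'⟩ hi⟩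
    choose δ hδ using hex
    exact ⟨δ, fun i hi hin => hδ i hi (hin.trans_eq hclass)⟩
  · have hδ' : ∀ i, 1 ≤ i → i ≤ n - 1 → PolyMap.HasDegree (PolyMap.modLC f i) (δ i) :=
      fun i hi hin => hδ i hi (hin.trans_eq hclass.symm)
    have hshort : ∀ i, 1 ≤ i → i ≤ n - 1 →
        ∃ M, IsGreatest (PolyMap.shortChainSums d i) M ∧ δ i ≤ M := by
      intro i hi hin
      obtain ⟨M, hM, hM'⟩ := hpoly i hi hin
      exact ⟨M, hM, (hδ' i hi hin).2 hM'⟩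
    have hchain : ∀ i, 1 ≤ i → i ≤ n - 1 → ⊥ ∉ PolyMap.superdiagonal d →
        ∃ M, IsGreatest (PolyMap.chainSums d i) M ∧ δ i ≤ M := by
      intro i hi hin hd
      obtain ⟨M, hM⟩ := PolyMap.exists_isGreatest_chainSums (d := d) (i := i) (by omega)
      exact ⟨M, hM,
        (hδ' i hi hin).2 (PolyMap.degreeLE_modLC_of_isGreatest_chainSums hdeg hd hin hM)⟩
    refine ⟨PolyMap.isGreatest_superdiagonal_of_hasDegree hn hdeg (hδ' 1 le_rfl (by omega)),
      fun i hi hin => ⟨?_, hshort i (by omega) hin, hchain i (by omega) hin⟩, ?_,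
      hshort (n - 1) (by omega) le_rfl, hchain (n - 1) (by omega) le_rfl⟩
    -- The reduction modulo $C^i$ is a homomorphic image of the reduction modulo $C^{i+1}$.
    · exact (hδ' (i - 1) (by omega) (by omega)).2
        ((hδ' i (by omega) hin).1.modLC_of_le (by omega))
    · have h := hδ' (n - 1) (by omega) le_rfl
      exact ⟨(PolyMap.degreeLE_modLC_iff hlast).mp h.1,
        fun e he => h.2 ((PolyMap.degreeLE_modLC_iff hlast).mpr he)⟩
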